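/- Let $N,d$ be natural numbers, let $A_1,\dots,A_N\subseteq\mathbb{R}^d$ be closed and convex, let $J_1,\dots,J_N:\mathbb{R}^{Nd}\to\mathbb{R}$ be differentiable, and put $\boldsymbol A=A_1\times\dots\times A_N$. Write $\boldsymbol a=(\boldsymbol a^1,\dots,\boldsymbol a^N)$ with $\boldsymbol a^i\in\mathbb{R}^d$ for the vectors of $\mathbb{R}^{Nd}$; all norms and inner products are Euclidean. The game mapping is $\boldsymbol M=(\boldsymbol M_1,\dots,\boldsymbol M_N):\mathbb{R}^{Nd}\to\mathbb{R}^{Nd}$, $\boldsymbol M_i(\boldsymbol a)=\nabla_{\boldsymbol a^i}J_i(\boldsymbol a)$. Assume: 1. $(\boldsymbol M(\boldsymbol a)-\boldsymbol M(\boldsymbol b),\boldsymbol a-\boldsymbol b)\ge 0$ for all $\boldsymbol a,\boldsymbol b\in\boldsymbol A$. 2. There is $\boldsymbol a^*\in\boldsymbol A$ with $(\boldsymbol M(\boldsymbol a^*),\boldsymbol a-\boldsymbol a^*)\ge 0$ for all $\boldsymbol a\in\boldsymbol A$. 3. Each $\boldsymbol M_i$ is Lipschitz continuous on $\mathbb{R}^{Nd}$.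 4. For each $i$ there are constants $K,Q$ such that $|J_i(\boldsymbol a)|\le K(1+\|\boldsymbol a\|)$ whenever $\|\boldsymbol a\|\ge Q$. 5. $\gamma(t)=t^{-a}$, $\sigma(t)=t^{-b}$, $\epsilon(t)=t^{-c}$ for all integers $t\ge 1$, with $a,b,c>0$, while $\gamma(0),\sigma(0),\epsilon(0)$ are arbitrary positive numbers; and, with $\beta(t)=\gamma(t)\sigma^2(t)$, $\sum_{t\ge0}\beta(t)=\infty$, $\lim_{t\to\infty}\epsilon(t)=0$, $\sum_{t\ge1}\bigl(1+\frac1{\beta(t)\epsilon(t)}\bigr)\frac{|\epsilon(t-1)-\epsilon(t)|^2}{\epsilon^2(t)}<\infty$, $\sum_{t\ge0}\gamma^2(t)<\infty$, $\sum_{t\ge0}\beta(t)\sigma(t)<\infty$, $\lim_{t\to\infty}\sigma(t)=0$, $\sum_{t\ge0}\beta(t)\epsilon(t)=\infty$. Let $\mathbf{x}(t),\boldsymbol\mu(t)$, $t=0,1,2,\dots$, be random vectors in $\mathbb{R}^{Nd}$ on a probability space such that $\boldsymbol\mu(0)$ is an arbitrary deterministic vector; for each $t$ the conditional distribution of $\mathbf{x}(t)$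 given $\mathbf{x}(k)$, $k<t$, and $\boldsymbol\mu(k)$, $k\le t$, is the normal distribution with mean $\boldsymbol\mu(t)$ and covariance matrix $\sigma^2(t)I$; and for each $t\ge 0$ and $i$ $$\boldsymbol\mu^i(t+1)=\mathrm{Proj}_{A_i}\Bigl[\boldsymbol\mu^i(t)-\gamma(t)\sigma^2(t)\Bigl(J_i(\mathbf{x}(t))\,\frac{\mathbf{x}^i(t)-\boldsymbol\mu^i(t)}{\sigma^2(t)}+\epsilon(t)\boldsymbol\mu^i(t)\Bigr)\Bigr],$$ where $\mathrm{Proj}_{A_i}$ is the Euclidean projection on $A_i$. Then $$\Pr\Bigl\{\sup_{t\ge0}\|\boldsymbol\mu(t)\|<\infty\Bigr\}=1 .$$ -/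

import Mathlib

open MeasureTheory ProbabilityTheory Filter Topology

noncomputable section

/-- `ℝ^d` with the Euclidean norm: the space containing the action set of one player. -/
abbrev ActionSpace (d : ℕ) : Type := EuclideanSpace ℝ (Fin d)

/-- `ℝ^{Nd}` with the Euclidean norm: joint actions; the coordinate `(i, k)` is the `k`-th
coordinate of the action of player `i`. -/
abbrev JointSpace (N d : ℕ) : Type := EuclideanSpace ℝ (Fin N × Fin d)

/-- The component `a^i ∈ ℝ^d` of player `i` in the joint vector `a ∈ ℝ^{Nd}`. -/
def block {N d : ℕ} (a : JointSpace N d) (i : Fin N) : ActionSpace d :=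
  WithLp.toLp 2 (fun k => a (i, k))

/-- A game with `N` players, action sets `A i ⊆ ℝ^d` and cost functions `J i : ℝ^{Nd} → ℝ`. -/
structure ContinuousGame (N d : ℕ) where
  /-- the action sets -/
  A : Fin N → Set (ActionSpace d)
  /-- the cost functions -/
  J : Fin N → JointSpace N d → ℝ

namespace ContinuousGame

variable {N d : ℕ}

/-- The set `A_1 × ⋯ × A_N` of joint actions. -/
def jointActions (G : ContinuousGame N d) : Set (JointSpace N d) :=
  {a | ∀ i, block a i ∈ G.A i}

/-- The game mapping `M`, with coordinates `M_{i,k}(a) = ∂J_i(a)/∂a^i_k`. -/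
def gameMapping (G : ContinuousGame N d) (a : JointSpace N d) : JointSpace N d :=
  WithLp.toLp 2 (fun p => fderiv ℝ (G.J p.1) a (EuclideanSpace.single p 1))

end ContinuousGame

/-- `T` is monotone over `X`. -/
def MonotoneMappingOn {n : Type*} [Fintype n]
    (T : EuclideanSpace ℝ n → EuclideanSpace ℝ n) (X : Set (EuclideanSpace ℝ n)) : Prop :=
  ∀ x ∈ X, ∀ y ∈ X, 0 ≤ inner ℝ (T x - T y) (x - y)

/-- The solution set `SOL(Y, T)` of the variational inequality `VI(Y, T)`. -/
def viSolutions {n : Type*} [Fintype n]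
    (Y : Set (EuclideanSpace ℝ n)) (T : EuclideanSpace ℝ n → EuclideanSpace ℝ n) :
    Set (EuclideanSpace ℝ n) :=
  {y | y ∈ Y ∧ ∀ z ∈ Y, 0 ≤ inner ℝ (T y) (z - y)}

/-- `|f|` grows not faster than a linear function of the norm as the argument tends to infinity. -/
def GrowsAtMostLinearly {n : Type*} [Fintype n] (f : EuclideanSpace ℝ n → ℝ) : Prop :=
  ∃ K Q : ℝ, ∀ a, Q ≤ ‖a‖ → |f a| ≤ K * (1 + ‖a‖)

/-- `v` is the Euclidean projection of `u` on `C` (it exists and is unique if `C` is nonempty,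
closed and convex). -/
def IsProjection {d : ℕ} (C : Set (ActionSpace d)) (u v : ActionSpace d) : Prop :=
  v ∈ C ∧ ∀ w ∈ C, ‖u - v‖ ≤ ‖u - w‖

/-- The conditions on the step size `γ(t) = t^{-a}`, the standard deviation `σ(t) = t^{-b}` and
the regularization parameter `ε(t) = t^{-c}`, with `β(t) = γ(t) σ(t)^2`. As `t^{-a}` makes no sense
at `t = 0`, the values at `t = 0` are arbitrary positive numbers. -/
structure StepSizeConditions (a b c : ℝ) (γ σ ε : ℕ → ℝ) : Prop where
  a_pos : 0 < a
  b_pos : 0 < b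
  c_pos : 0 < c
  gamma_zero_pos : 0 < γ 0
  sigma_zero_pos : 0 < σ 0
  eps_zero_pos : 0 < ε 0
  gamma_eq : ∀ t : ℕ, 1 ≤ t → γ t = 1 / (t : ℝ) ^ a
  sigma_eq : ∀ t : ℕ, 1 ≤ t → σ t = 1 / (t : ℝ) ^ b
  eps_eq : ∀ t : ℕ, 1 ≤ t → ε t = 1 / (t : ℝ) ^ c
  sum_beta : Tendsto (fun n => ∑ t ∈ Finset.range n, γ t * σ t ^ 2) atTop atTop
  tendsto_eps : Tendsto ε atTop (𝓝 0)
  summable_eps_variation : Summable (fun t : ℕ =>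
    (1 + 1 / (γ (t + 1) * σ (t + 1) ^ 2 * ε (t + 1))) *
      (|ε t - ε (t + 1)| ^ 2 / ε (t + 1) ^ 2))
  summable_gamma_sq : Summable (fun t => γ t ^ 2)
  summable_beta_sigma : Summable (fun t => γ t * σ t ^ 2 * σ t)
  tendsto_sigma : Tendsto σ atTop (𝓝 0)
  sum_beta_eps : Tendsto (fun n => ∑ t ∈ Finset.range n, γ t * σ t ^ 2 * ε t) atTop atTop

/-- The normal distribution on `ℝ^{Nd}` with mean `m` and covariance matrix `s^2 I`: the
coordinates are independent, and the coordinate `p` has the law `N(m p, s^2)`. -/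
def isotropicGaussian {N d : ℕ} (m : JointSpace N d) (s : ℝ) : Measure (JointSpace N d) :=
  (Measure.pi (fun p => gaussianReal (m p) (s ^ 2).toNNReal)).map (WithLp.toLp 2)

/-- The information available just before the states at time `t` are drawn: the σ-algebra generated
by `x(k)`, `k < t`, and `μ(k)`, `k ≤ t`. -/
abbrev history {N d : ℕ} {Ω : Type*} (x μ : ℕ → Ω → JointSpace N d) (t : ℕ) : MeasurableSpace Ω :=
  (⨆ k, ⨆ _ : k < t, MeasurableSpace.comap (x k) inferInstance) ⊔
    (⨆ k, ⨆ _ : k ≤ t, MeasurableSpace.comap (μ k) inferInstance)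

/-- The random sequences `x(t)` (states) and `μ(t)` (means) on the probability space `(Ω, P)` form a
run of the regularized payoff-based algorithm started at `μ(0) = μ₀`. -/
structure IsPayoffBasedRun {N d : ℕ} (G : ContinuousGame N d) (γ σ ε : ℕ → ℝ)
    (μ₀ : JointSpace N d) {Ω : Type*} [MeasurableSpace Ω] (P : Measure Ω)
    (x μ : ℕ → Ω → JointSpace N d) : Prop where
  measurable_state : ∀ t, Measurable (x t)
  measurable_mean : ∀ t, Measurable (μ t)
  init : ∀ ω, μ 0 ω = μ₀
  /-- Given the past, the joint state `x(t)` has the law `N(μ(t), σ(t)^2 I)`. -/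
  state_law : ∀ t, ∀ B : Set (JointSpace N d), MeasurableSet B →
    P⟦x t ⁻¹' B | history x μ t⟧ =ᵐ[P] fun ω => (isotropicGaussian (μ t ω) (σ t)).real B
  /-- The update of the mean of player `i`, who observes the value `J_i(x(t))` only. -/
  update : ∀ t ω i, IsProjection (G.A i)
    (block (μ t ω) i - (γ t * σ t ^ 2) •
      (G.J i (x t ω) • ((σ t ^ 2)⁻¹ • (block (x t ω) i - block (μ t ω) i))
        + ε t • block (μ t ω) i))
    (block (μ (t + 1) ω) i)

end

/-!
Let `a` solve the variational inequality and let `q` be the displacement from a mean `m` back to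
the ball around `a` whose sphere passes through the origin. Outside of this ball the regularizing
drift `-ε m` does not increase `‖q‖`, and neither does the exact gradient step, since by
monotonicity `a` also solves the dual variational inequality `0 ≤ ⟪M m, m - a⟫`. The projection
does not increase `‖q‖` either, because convexity keeps `m - q` in the action set.

It remains to control the randomness. The sampled direction `J_i(x) (x^i - m^i)`, `x ∼ N(m, s² I)`,
has mean `s² M_i(m) + O(s³)`: averaging it over `z` and the mirror image of `z` in a coordinate
hyperplane turns `J_i` into a difference quotient, so that only the Lipschitz constant of `M_i`
enters. By linear growth its second moment is `O(1 + ‖m‖²)`. Hence `V = 1 + ‖q‖²` satisfies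
`E[V(μ(t+1)) | past] ≤ (1 + θ(t)) V(μ(t))` with `θ = O(γ σ³ + γ²)` summable, so
`V(μ(t)) / ∏_{k < t} (1 + θ(k))` is a nonnegative supermartingale and almost surely bounded.
-/

theorem block_sub {N d : ℕ} (a b : JointSpace N d) (i : Fin N) :
    block (a - b) i = block a i - block b i := rfl

theorem norm_sq_eq_sum_norm_block_sq {N d : ℕ} (a : JointSpace N d) :
    ‖a‖ ^ 2 = ∑ i, ‖block a i‖ ^ 2 := by
  simp only [EuclideanSpace.norm_sq_eq, Fintype.sum_prod_type, block]

theorem IsProjection.norm_sub_le {d : ℕ} {C : Set (ActionSpace d)} (hC : Convex ℝ C)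
    {u v w : ActionSpace d} (h : IsProjection C u v) (hw : w ∈ C) : ‖v - w‖ ≤ ‖u - w‖ := by
  have : Nonempty C := ⟨⟨v, h.1⟩⟩
  have hinf : ‖u - v‖ = ⨅ z : C, ‖u - z‖ :=
    le_antisymm (le_ciInf fun z => h.2 z z.2)
      (ciInf_le (f := fun z : C => ‖u - z‖) ⟨0, Set.forall_mem_range.2 fun z => norm_nonneg _⟩
        ⟨v, h.1⟩)
  have hangle : inner ℝ (u - v) (w - v) ≤ 0 :=
    (norm_eq_iInf_iff_real_inner_le_zero hC h.1).1 hinf w hw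
  have hexpand : ‖u - w‖ ^ 2 = ‖u - v‖ ^ 2 - 2 * inner ℝ (u - v) (w - v) + ‖v - w‖ ^ 2 := by
    rw [norm_sub_rev v w, ← norm_sub_sq_real, sub_sub_sub_cancel_right]
  refine le_of_sq_le_sq ?_ (norm_nonneg _)
  linarith [sq_nonneg ‖u - v‖]

theorem ContinuousGame.convex_jointActions {N d : ℕ} {G : ContinuousGame N d}
    (hA : ∀ i, Convex ℝ (G.A i)) : Convex ℝ G.jointActions :=
  fun _ hu _ hv _ _ hs ht hst i => hA i (hu i) (hv i) hs ht hst

theorem ContinuousGame.norm_sub_le_of_isProjection_block {N d : ℕ} {G : ContinuousGame N d}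
    (hA : ∀ i, Convex ℝ (G.A i)) {u v w : JointSpace N d}
    (huv : ∀ i, IsProjection (G.A i) (block u i) (block v i)) (hw : w ∈ G.jointActions) :
    ‖v - w‖ ≤ ‖u - w‖ := by
  refine le_of_sq_le_sq ?_ (norm_nonneg _)
  rw [norm_sq_eq_sum_norm_block_sq, norm_sq_eq_sum_norm_block_sq]
  refine Finset.sum_le_sum fun i _ => pow_le_pow_left₀ (norm_nonneg _) ?_ 2
  rw [block_sub, block_sub]
  exact (huv i).norm_sub_le (hA i) (hw i)

/-- The solutions of the Minty (dual) variational inequality over `Y`: unlike in `viSolutions`, the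
operator is evaluated at the competitor. -/
def mintySolutions {n : Type*} [Fintype n]
    (Y : Set (EuclideanSpace ℝ n)) (T : EuclideanSpace ℝ n → EuclideanSpace ℝ n) :
    Set (EuclideanSpace ℝ n) :=
  {y | y ∈ Y ∧ ∀ z ∈ Y, 0 ≤ inner ℝ (T z) (z - y)}

theorem MonotoneMappingOn.viSolutions_subset_mintySolutions {n : Type*} [Fintype n]
    {T : EuclideanSpace ℝ n → EuclideanSpace ℝ n} {Y : Set (EuclideanSpace ℝ n)}
    (hT : MonotoneMappingOn T Y) : viSolutions Y T ⊆ mintySolutions Y T := by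
  rintro y ⟨hyY, hy⟩
  refine ⟨hyY, fun z hz => ?_⟩
  have hmono := hT z hz y hyY
  rw [inner_sub_left] at hmono
  linarith [hy z hz]

section BallExcess

variable {E : Type*} [NormedAddCommGroup E]

section NormedSpace

variable [NormedSpace ℝ E]

/-- The displacement from `m` back to the closed ball of radius `R ≥ 0` around `a`: the difference
of `m` and its radial retraction to the ball, with `0 / 0 = 0` covering `m = a`. `excessEnergy` is
built from its squared norm. -/
noncomputable def ballExcess (a : E) (R : ℝ) (m : E) : E :=
  (max (‖m - a‖ - R) 0 / ‖m - a‖) • (m - a)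

theorem exists_ballExcess_eq_smul {R : ℝ} (hR : 0 ≤ R) (a m : E) :
    ∃ t ∈ Set.Icc (0 : ℝ) 1, ballExcess a R m = t • (m - a) :=
  ⟨_, ⟨by positivity, div_le_one_of_le₀ (max_le (by linarith) (norm_nonneg _)) (norm_nonneg _)⟩,
    rfl⟩

theorem norm_ballExcess {R : ℝ} (hR : 0 ≤ R) (a m : E) :
    ‖ballExcess a R m‖ = max (‖m - a‖ - R) 0 := by
  rw [ballExcess, norm_smul, Real.norm_of_nonneg (by positivity)]
  rcases eq_or_ne ‖m - a‖ 0 with h | h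
  · simp [h, hR]
  · rw [div_mul_cancel₀ _ h]

theorem ballExcess_eq_zero {R : ℝ} {a m : E} (h : ‖m - a‖ ≤ R) : ballExcess a R m = 0 := by
  rw [ballExcess, max_eq_right (by linarith), zero_div, zero_smul]

theorem norm_sub_ballExcess_sub_le {R : ℝ} (hR : 0 ≤ R) (a m : E) :
    ‖m - ballExcess a R m - a‖ ≤ R := by
  rcases le_total ‖m - a‖ R with h | h
  · rwa [ballExcess_eq_zero h, sub_zero]
  · obtain ⟨t, ⟨ht₀, ht₁⟩, ht⟩ := exists_ballExcess_eq_smul hR a m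
    have hnorm := norm_ballExcess hR a m
    rw [ht, norm_smul, Real.norm_of_nonneg ht₀, max_eq_left (by linarith)] at hnorm
    have hsub : m - ballExcess a R m - a = (1 - t) • (m - a) := by rw [ht]; module
    rw [hsub, norm_smul, Real.norm_of_nonneg (by linarith)]
    linarith

theorem sub_ballExcess_mem {A : Set E} (hA : Convex ℝ A) {R : ℝ} (hR : 0 ≤ R) {a m : E}
    (ha : a ∈ A) (hm : m ∈ A) : m - ballExcess a R m ∈ A := by
  obtain ⟨t, ht, hexcess⟩ := exists_ballExcess_eq_smul hR a m
  convert hA.add_smul_sub_mem hm ha ht using 1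
  rw [hexcess]
  module

theorem norm_ballExcess_le_norm_sub {R : ℝ} (hR : 0 ≤ R) {a w : E} (hw : ‖w - a‖ ≤ R) (m : E) :
    ‖ballExcess a R m‖ ≤ ‖m - w‖ := by
  rw [norm_ballExcess hR]
  exact max_le (by linarith [norm_sub_le_norm_sub_add_norm_sub m w a]) (norm_nonneg _)

theorem norm_le_norm_ballExcess_add {R : ℝ} (hR : 0 ≤ R) (a m : E) :
    ‖m‖ ≤ ‖ballExcess a R m‖ + (‖a‖ + R) := by
  rw [norm_ballExcess hR]
  linarith [norm_le_norm_sub_add m a, le_max_left (‖m - a‖ - R) 0]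

@[fun_prop]
theorem measurable_ballExcess [MeasurableSpace E] [BorelSpace E] [SecondCountableTopology E]
    (a : E) (R : ℝ) : Measurable (ballExcess a R) := by
  unfold ballExcess
  fun_prop

/-- The Lyapunov function of the algorithm. The radius `‖a‖` is the smallest one for which the
regularizing term `m` points out of the ball around `a` at every point `m` outside of it. -/
noncomputable def excessEnergy (a m : E) : ℝ := 1 + ‖ballExcess a ‖a‖ m‖ ^ 2

theorem excessEnergy_nonneg (a m : E) : 0 ≤ excessEnergy a m := by
  unfold excessEnergy
  positivity

theorem one_add_norm_sq_le_mul_excessEnergy (a m : E) :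
    1 + ‖m‖ ^ 2 ≤ (2 + 8 * ‖a‖ ^ 2) * excessEnergy a m := by
  unfold excessEnergy
  set q := ‖ballExcess a ‖a‖ m‖
  have hm : ‖m‖ ^ 2 ≤ (q + (‖a‖ + ‖a‖)) ^ 2 := by
    gcongr
    exact norm_le_norm_ballExcess_add (norm_nonneg a) a m
  nlinarith [sq_nonneg (q - 2 * ‖a‖), mul_nonneg (sq_nonneg ‖a‖) (sq_nonneg q)]

end NormedSpace

/-- The relative growth of the excess energy in one step of size `g` and noise level `s`, if `C`
controls bias and second moment of the gradient estimate and `T` the regularization. -/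
noncomputable def energyGrowth (a : E) (C T g s : ℝ) : ℝ :=
  C * (g * s ^ 2 * s) + 2 * (C + T ^ 2) * (2 + 8 * ‖a‖ ^ 2) * g ^ 2

theorem energyGrowth_nonneg (a : E) {C g s : ℝ} (hC : 0 ≤ C) (T : ℝ) (hg : 0 ≤ g) (hs : 0 ≤ s) :
    0 ≤ energyGrowth a C T g s := by
  unfold energyGrowth
  positivity

theorem summable_energyGrowth (a : E) (C T : ℝ) {γ σ : ℕ → ℝ} (hγ : Summable fun t => γ t ^ 2)
    (hγσ : Summable fun t => γ t * σ t ^ 2 * σ t) :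
    Summable fun t => energyGrowth a C T (γ t) (σ t) :=
  (hγσ.mul_left C).add (hγ.mul_left _)

variable [InnerProductSpace ℝ E]

theorem inner_ballExcess_nonneg {R : ℝ} (hR : 0 ≤ R) {a m v : E} (h : 0 ≤ inner ℝ v (m - a)) :
    0 ≤ inner ℝ v (ballExcess a R m) := by
  obtain ⟨t, ⟨ht₀, _⟩, hexcess⟩ := exists_ballExcess_eq_smul hR a m
  rw [hexcess, real_inner_smul_right]
  positivity

theorem inner_self_ballExcess_nonneg {R : ℝ} {a : E} (ha : ‖a‖ ≤ R) (m : E) :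
    0 ≤ inner ℝ m (ballExcess a R m) := by
  rcases le_total ‖m - a‖ R with h | h
  · rw [ballExcess_eq_zero h, inner_zero_right]
  · refine inner_ballExcess_nonneg ((norm_nonneg a).trans ha) ?_
    have hinner : inner ℝ m (m - a) = ‖m - a‖ ^ 2 + inner ℝ a (m - a) := by
      rw [← real_inner_self_eq_norm_sq, ← inner_add_left, sub_add_cancel]
    have hcs := neg_le_of_abs_le (abs_real_inner_le_norm a (m - a))
    nlinarith [norm_nonneg (m - a)]

theorem expected_energy_le_mul_excessEnergy {a m M b : E} (hM : 0 ≤ inner ℝ M (m - a))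
    {C T g s κ H : ℝ} (hC : 0 ≤ C) (hg : 0 ≤ g) (hκ : 0 ≤ κ) (hκT : κ ≤ g * T)
    (hb : ‖b - s ^ 2 • M‖ ≤ C * s ^ 3) (hH : H ≤ C * (1 + ‖m‖ ^ 2)) :
    1 + (‖ballExcess a ‖a‖ m‖ ^ 2 - 2 * g * inner ℝ b (ballExcess a ‖a‖ m)
        - 2 * κ * inner ℝ m (ballExcess a ‖a‖ m) + 2 * g ^ 2 * H + 2 * κ ^ 2 * ‖m‖ ^ 2)
      ≤ (1 + energyGrowth a C T g s) * excessEnergy a m := by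
  set q := ballExcess a ‖a‖ m
  have hV : excessEnergy a m = 1 + ‖q‖ ^ 2 := rfl
  have hregularization : 0 ≤ 2 * κ * inner ℝ m q :=
    mul_nonneg (by positivity) (inner_self_ballExcess_nonneg le_rfl m)
  have hgradient : -(2 * g * inner ℝ b q) ≤ C * (g * s ^ 2 * s) * excessEnergy a m := by
    have hMq : 0 ≤ inner ℝ M q := inner_ballExcess_nonneg (norm_nonneg a) hM
    have hbias : -inner ℝ b q ≤ C * s ^ 3 * ‖q‖ := by
      have hcs := neg_le_of_abs_le (abs_real_inner_le_norm (b - s ^ 2 • M) q)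
      rw [inner_sub_left, real_inner_smul_left] at hcs
      nlinarith [mul_le_mul_of_nonneg_right hb (norm_nonneg q), mul_nonneg (sq_nonneg s) hMq]
    have hs : 0 ≤ C * s ^ 3 := (norm_nonneg _).trans hb
    calc -(2 * g * inner ℝ b q) = 2 * g * -inner ℝ b q := by ring
      _ ≤ 2 * g * (C * s ^ 3 * ‖q‖) := by gcongr
      _ = g * (C * s ^ 3) * (2 * ‖q‖) := by ring
      _ ≤ g * (C * s ^ 3) * excessEnergy a m := by
        gcongr
        rw [hV]
        nlinarith [sq_nonneg (‖q‖ - 1)]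
      _ = _ := by ring
  have hsecond : 2 * g ^ 2 * H + 2 * κ ^ 2 * ‖m‖ ^ 2
      ≤ 2 * (C + T ^ 2) * (2 + 8 * ‖a‖ ^ 2) * g ^ 2 * excessEnergy a m :=
    calc 2 * g ^ 2 * H + 2 * κ ^ 2 * ‖m‖ ^ 2
        ≤ 2 * g ^ 2 * (C * (1 + ‖m‖ ^ 2)) + 2 * (g * T) ^ 2 * (1 + ‖m‖ ^ 2) := by
          gcongr
          linarith
      _ = 2 * (C + T ^ 2) * g ^ 2 * (1 + ‖m‖ ^ 2) := by ring
      _ ≤ 2 * (C + T ^ 2) * g ^ 2 * ((2 + 8 * ‖a‖ ^ 2) * excessEnergy a m) := by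
          gcongr
          exact one_add_norm_sq_le_mul_excessEnergy a m
      _ = _ := by ring
  unfold energyGrowth
  linarith

end BallExcess

theorem integral_norm_sub_smul_sub_smul_sq_le {α E : Type*} [NormedAddCommGroup E]
    [InnerProductSpace ℝ E] [CompleteSpace E] [MeasurableSpace α] {ν : Measure α}
    [IsProbabilityMeasure ν] {Y : α → E} (hY : MemLp Y 2 ν) (q m : E) (g κ : ℝ) :
    ∫ y, ‖q - g • Y y - κ • m‖ ^ 2 ∂ν
      ≤ ‖q‖ ^ 2 - 2 * g * inner ℝ (∫ y, Y y ∂ν) q - 2 * κ * inner ℝ m q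
        + 2 * g ^ 2 * ∫ y, ‖Y y‖ ^ 2 ∂ν + 2 * κ ^ 2 * ‖m‖ ^ 2 := by
  have hYint : Integrable Y ν := hY.integrable one_le_two
  have hYinner : Integrable (fun y => 2 * g * inner ℝ q (Y y)) ν :=
    (hYint.const_inner q).const_mul _
  have hYsq : Integrable (fun y => 2 * g ^ 2 * ‖Y y‖ ^ 2) ν :=
    (hY.integrable_norm_pow two_ne_zero).const_mul _
  set c := ‖q‖ ^ 2 - 2 * κ * inner ℝ m q + 2 * κ ^ 2 * ‖m‖ ^ 2 with hc
  have hlinear : Integrable (fun y => c - 2 * g * inner ℝ q (Y y)) ν :=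
    (integrable_const c).sub hYinner
  have hpoint (y : α) : ‖q - g • Y y - κ • m‖ ^ 2
      ≤ c - 2 * g * inner ℝ q (Y y) + 2 * g ^ 2 * ‖Y y‖ ^ 2 := by
    have hpar := parallelogram_law_with_norm ℝ (g • Y y) (κ • m)
    have hYn : ‖g • Y y‖ ^ 2 = g ^ 2 * ‖Y y‖ ^ 2 := by
      rw [norm_smul, mul_pow, Real.norm_eq_abs, sq_abs]
    have hmn : ‖κ • m‖ ^ 2 = κ ^ 2 * ‖m‖ ^ 2 := by
      rw [norm_smul, mul_pow, Real.norm_eq_abs, sq_abs]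
    rw [sub_sub, norm_sub_sq_real, inner_add_right, real_inner_smul_right, real_inner_smul_right,
      real_inner_comm m q, hc]
    nlinarith [sq_nonneg ‖g • Y y - κ • m‖]
  calc ∫ y, ‖q - g • Y y - κ • m‖ ^ 2 ∂ν
      ≤ ∫ y, (c - 2 * g * inner ℝ q (Y y) + 2 * g ^ 2 * ‖Y y‖ ^ 2) ∂ν :=
        integral_mono_of_nonneg (Eventually.of_forall fun y => sq_nonneg _)
          (hlinear.add hYsq) (Eventually.of_forall hpoint)
    _ = _ := by
      rw [integral_add hlinear hYsq,
        integral_sub (integrable_const c) hYinner, integral_const_mul, integral_const_mul,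
        integral_inner hYint, integral_const, probReal_univ, one_smul,
        real_inner_comm q (∫ y, Y y ∂ν)]
      ring

section Supermartingale

variable {Ω : Type*} {m0 : MeasurableSpace Ω} {P : Measure Ω} [IsFiniteMeasure P]
  {ℱ : Filtration ℕ m0}

theorem ae_bddAbove_range_of_supermartingale {Y : ℕ → Ω → ℝ} (hY : Supermartingale Y ℱ P)
    (hnn : ∀ n ω, 0 ≤ Y n ω) : ∀ᵐ ω ∂P, BddAbove (Set.range fun n => Y n ω) := by
  have hnorm (n : ℕ) : eLpNorm ((-Y) n) 1 P ≤ (∫ ω, Y 0 ω ∂P).toNNReal := by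
    have hmean : ∫ ω, Y n ω ∂P ≤ ∫ ω, Y 0 ω ∂P := by
      simpa using hY.setIntegral_le (Nat.zero_le n) MeasurableSet.univ
    rw [Pi.neg_apply, eLpNorm_neg, eLpNorm_one_eq_lintegral_enorm,
      ← ofReal_integral_norm_eq_lintegral_enorm (hY.integrable n)]
    simp only [Real.norm_of_nonneg (hnn n _)]
    exact ENNReal.ofReal_le_ofReal hmean
  filter_upwards [hY.neg.exists_ae_tendsto_of_bdd hnorm] with ω ⟨c, hc⟩
  simpa using hc.neg.bddAbove_range

variable {X : ℕ → Ω → ℝ} {θ : ℕ → ℝ}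

theorem supermartingale_inv_prod_mul (hX : ∀ n, Measurable[ℱ n] (X n))
    (hint : ∀ n, Integrable (X n) P) (hθ : ∀ n, 0 ≤ θ n)
    (hstep : ∀ n s, MeasurableSet[ℱ n] s →
      ∫ ω in s, X (n + 1) ω ∂P ≤ (1 + θ n) * ∫ ω in s, X n ω ∂P) :
    Supermartingale (fun n ω => (∏ k ∈ Finset.range n, (1 + θ k))⁻¹ * X n ω) ℱ P := by
  refine supermartingale_of_setIntegral_succ_le
    (fun n => ((hX n).const_mul _).stronglyMeasurable) (fun n => (hint n).const_mul _)
    fun n s hs => ?_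
  have hpos (k : ℕ) : 0 < 1 + θ k := by linarith [hθ k]
  have hprod : 0 < ∏ k ∈ Finset.range n, (1 + θ k) := Finset.prod_pos fun k _ => hpos k
  rw [integral_const_mul, integral_const_mul, Finset.prod_range_succ, mul_inv, mul_assoc]
  gcongr
  rw [inv_mul_le_iff₀ (hpos n)]
  exact hstep n s hs

theorem ae_bddAbove_range_of_setIntegral_succ_le (hX : ∀ n, Measurable[ℱ n] (X n))
    (hint : ∀ n, Integrable (X n) P) (hnn : ∀ n ω, 0 ≤ X n ω) (hθ : ∀ n, 0 ≤ θ n)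
    (hsum : Summable θ)
    (hstep : ∀ n s, MeasurableSet[ℱ n] s →
      ∫ ω in s, X (n + 1) ω ∂P ≤ (1 + θ n) * ∫ ω in s, X n ω ∂P) :
    ∀ᵐ ω ∂P, BddAbove (Set.range fun n => X n ω) := by
  set p : ℕ → ℝ := fun n => ∏ k ∈ Finset.range n, (1 + θ k)
  have hp_pos (n : ℕ) : 0 < p n := Finset.prod_pos fun k _ => by linarith [hθ k]
  have hp_le (n : ℕ) : p n ≤ Real.exp (∑' k, θ k) :=
    (Real.prod_one_add_le_exp_sum _ hθ).trans
      (Real.exp_le_exp.2 (hsum.sum_le_tsum _ fun k _ => hθ k))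
  have hY_nonneg (n : ℕ) (ω : Ω) : 0 ≤ (p n)⁻¹ * X n ω :=
    mul_nonneg (inv_nonneg.2 (hp_pos n).le) (hnn n ω)
  filter_upwards [ae_bddAbove_range_of_supermartingale
    (supermartingale_inv_prod_mul hX hint hθ hstep) hY_nonneg] with ω ⟨B, hB⟩
  refine ⟨Real.exp (∑' k, θ k) * B, ?_⟩
  rintro _ ⟨n, rfl⟩
  have hXB : (p n)⁻¹ * X n ω ≤ B := hB ⟨n, rfl⟩
  calc X n ω ≤ p n * B := (inv_mul_le_iff₀ (hp_pos n)).1 hXB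
    _ ≤ Real.exp (∑' k, θ k) * B :=
      mul_le_mul_of_nonneg_right (hp_le n) ((hY_nonneg n ω).trans hXB)

theorem ae_bddAbove_range_of_setLIntegral_succ_le (hX : ∀ n, Measurable[ℱ n] (X n))
    (hnn : ∀ n ω, 0 ≤ X n ω) (h0 : ∫⁻ ω, ENNReal.ofReal (X 0 ω) ∂P ≠ ⊤) (hθ : ∀ n, 0 ≤ θ n)
    (hsum : Summable θ)
    (hstep : ∀ n s, MeasurableSet[ℱ n] s → ∫⁻ ω in s, ENNReal.ofReal (X (n + 1) ω) ∂P
      ≤ ENNReal.ofReal (1 + θ n) * ∫⁻ ω in s, ENNReal.ofReal (X n ω) ∂P) :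
    ∀ᵐ ω ∂P, BddAbove (Set.range fun n => X n ω) := by
  have hfin (n : ℕ) : ∫⁻ ω, ENNReal.ofReal (X n ω) ∂P ≠ ⊤ := by
    induction n with
    | zero => exact h0
    | succ n ih =>
      have h := hstep n Set.univ MeasurableSet.univ
      rw [Measure.restrict_univ] at h
      exact ne_top_of_le_ne_top (ENNReal.mul_ne_top ENNReal.ofReal_ne_top ih) h
  have hXm (n : ℕ) : AEStronglyMeasurable (X n) P :=
    ((hX n).mono (ℱ.le n) le_rfl).aestronglyMeasurable
  have hint (n : ℕ) : Integrable (X n) P :=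
    (lintegral_ofReal_ne_top_iff_integrable (hXm n) (Eventually.of_forall (hnn n))).1 (hfin n)
  have hofReal (n : ℕ) (s : Set Ω) :
      ∫⁻ ω in s, ENNReal.ofReal (X n ω) ∂P = ENNReal.ofReal (∫ ω in s, X n ω ∂P) :=
    (ofReal_integral_eq_lintegral_ofReal (hint n).integrableOn
      (Eventually.of_forall (hnn n))).symm
  refine ae_bddAbove_range_of_setIntegral_succ_le hX hint hnn hθ hsum fun n s hs => ?_
  have hpos : 0 ≤ 1 + θ n := by linarith [hθ n]
  have h := hstep n s hs
  rw [hofReal, hofReal, ← ENNReal.ofReal_mul hpos] at h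
  exact (ENNReal.ofReal_le_ofReal_iff
    (mul_nonneg hpos (integral_nonneg (hnn n)))).1 h

end Supermartingale

section ConditionalLaw

variable {Ω α β : Type*} {ℋ m0 : MeasurableSpace Ω} [MeasurableSpace α] [MeasurableSpace β]
  {P : Measure Ω} [IsFiniteMeasure P] {U : Ω → α} {V : Ω → β} {κ : Kernel α β} [IsFiniteKernel κ]

theorem map_restrict_prodMk_eq_compProd (hℋ : ℋ ≤ m0) (hU : Measurable[ℋ] U) (hV : Measurable V)
    (hlaw : ∀ B, MeasurableSet B → P⟦V ⁻¹' B | ℋ⟧ =ᵐ[P] fun ω => (κ (U ω)).real B) {s : Set Ω}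
    (hs : MeasurableSet[ℋ] s) :
    (P.restrict s).map (fun ω => (U ω, V ω)) = (P.restrict s).map U ⊗ₘ κ := by
  have hU' : Measurable U := hU.mono hℋ le_rfl
  refine Measure.ext_prod fun {A B} hA hB => ?_
  have hreal : P.real (V ⁻¹' B ∩ (U ⁻¹' A ∩ s)) = ∫ ω in U ⁻¹' A ∩ s, (κ (U ω)).real B ∂P :=
    calc P.real (V ⁻¹' B ∩ (U ⁻¹' A ∩ s))
        = ∫ ω in U ⁻¹' A ∩ s, (P⟦V ⁻¹' B | ℋ⟧) ω ∂P := by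
          rw [setIntegral_condExp hℋ ((integrable_const (1 : ℝ)).indicator (hV hB))
              ((hU hA).inter hs),
            integral_indicator (hV hB), Measure.restrict_restrict (hV hB)]
          simp
      _ = ∫ ω in U ⁻¹' A ∩ s, (κ (U ω)).real B ∂P :=
          integral_congr_ae (ae_restrict_of_ae (hlaw B hB))
  have hint : Integrable (fun ω => (κ (U ω)).real B) P := integrable_condExp.congr (hlaw B hB)
  have hlintegral : P (V ⁻¹' B ∩ (U ⁻¹' A ∩ s)) = ∫⁻ ω in U ⁻¹' A ∩ s, κ (U ω) B ∂P := by
    rw [← ofReal_measureReal, hreal, ofReal_integral_eq_lintegral_ofReal hint.integrableOn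
      (Eventually.of_forall fun ω => measureReal_nonneg)]
    exact lintegral_congr fun ω => ofReal_measureReal
  rw [Measure.map_apply (hU'.prodMk hV) (hA.prod hB),
    Measure.restrict_apply ((hU'.prodMk hV) (hA.prod hB)), Measure.compProd_apply_prod hA hB,
    setLIntegral_map hA (κ.measurable_coe hB) hU', Measure.restrict_restrict (hU' hA),
    ← hlintegral, Set.mk_preimage_prod, Set.inter_comm (U ⁻¹' A), Set.inter_assoc]

theorem setLIntegral_prodMk_eq_setLIntegral_lintegral (hℋ : ℋ ≤ m0) (hU : Measurable[ℋ] U)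
    (hV : Measurable V)
    (hlaw : ∀ B, MeasurableSet B → P⟦V ⁻¹' B | ℋ⟧ =ᵐ[P] fun ω => (κ (U ω)).real B) {s : Set Ω}
    (hs : MeasurableSet[ℋ] s) {F : α × β → ENNReal} (hF : Measurable F) :
    ∫⁻ ω in s, F (U ω, V ω) ∂P = ∫⁻ ω in s, ∫⁻ y, F (U ω, y) ∂κ (U ω) ∂P := by
  have hU' : Measurable U := hU.mono hℋ le_rfl
  rw [← lintegral_map hF (hU'.prodMk hV), map_restrict_prodMk_eq_compProd hℋ hU hV hlaw hs,
    Measure.lintegral_compProd hF, lintegral_map hF.lintegral_kernel_prod_right' hU']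

end ConditionalLaw

section GaussianSmoothing

theorem abs_sub_sub_mul_fderiv_le {E : Type*} [NormedAddCommGroup E] [NormedSpace ℝ E] {f : E → ℝ}
    (hf : Differentiable ℝ f) {e : E} {L : NNReal} (hL : LipschitzWith L fun a => fderiv ℝ f a e)
    {m x : E} {c r : ℝ} (hx : ‖x - m‖ ≤ r) (hxc : ‖x + c • e - m‖ ≤ r) :
    |f (x + c • e) - f x - c * fderiv ℝ f m e| ≤ |c| * (L * r) := by
  rw [← mem_closedBall_iff_norm] at hx hxc
  have hball : Convex ℝ (Metric.closedBall m r) := convex_closedBall m r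
  obtain ⟨z, hz, hfz⟩ := domain_mvt (fun y _ => (hf y).hasFDerivAt.hasFDerivWithinAt) hball hx hxc
  have hzm : ‖z - m‖ ≤ r := mem_closedBall_iff_norm.1 (hball.segment_subset hx hxc hz)
  rw [hfz, add_sub_cancel_left, map_smul, smul_eq_mul, ← mul_sub, abs_mul]
  gcongr
  exact (hL.norm_sub_le z m).trans (by gcongr)

theorem norm_sq_add_smul_le_of_norm_le_mul {E F : Type*} [NormedAddCommGroup E] [NormedSpace ℝ E]
    [NormedAddCommGroup F] {Y : E → F} {m : E} {K S s : ℝ} (hs : 0 ≤ s) (hsS : s ≤ S)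
    (hY : ∀ y, ‖Y y‖ ≤ K * (1 + ‖y‖) * ‖y - m‖) (z : E) :
    ‖Y (m + s • z)‖ ^ 2
      ≤ 3 * K ^ 2 * S ^ 2 * (1 + ‖m‖ ^ 2) * (‖z‖ ^ 2 + S ^ 2 * ‖z‖ ^ 4) := by
  have hsz : ‖s • z‖ ≤ S * ‖z‖ := by
    rw [norm_smul, Real.norm_of_nonneg hs]
    gcongr
  have hgrowth : (1 + ‖m + s • z‖) ^ 2 ≤ 3 * (1 + ‖m‖ ^ 2) * (1 + (S * ‖z‖) ^ 2) :=
    calc (1 + ‖m + s • z‖) ^ 2 ≤ (1 + (‖m‖ + S * ‖z‖)) ^ 2 := by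
          gcongr
          exact (norm_add_le _ _).trans (by gcongr)
      _ ≤ 3 * (1 + ‖m‖ ^ 2) * (1 + (S * ‖z‖) ^ 2) := by
          nlinarith [sq_nonneg (1 - ‖m‖), sq_nonneg (1 - S * ‖z‖), sq_nonneg (‖m‖ - S * ‖z‖),
            sq_nonneg (‖m‖ * (S * ‖z‖))]
  calc ‖Y (m + s • z)‖ ^ 2 ≤ (K * (1 + ‖m + s • z‖) * ‖s • z‖) ^ 2 := by
        gcongr
        simpa using hY (m + s • z)
    _ = K ^ 2 * (1 + ‖m + s • z‖) ^ 2 * ‖s • z‖ ^ 2 := by ring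
    _ ≤ K ^ 2 * (3 * (1 + ‖m‖ ^ 2) * (1 + (S * ‖z‖) ^ 2)) * (S * ‖z‖) ^ 2 := by gcongr
    _ = _ := by ring

variable {E : Type*} [NormedAddCommGroup E] [InnerProductSpace ℝ E]

theorem reflection_orthogonal_span_singleton_apply {e : E} (he : ‖e‖ = 1) (z : E) :
    (ℝ ∙ e)ᗮ.reflection z = z - (2 * inner ℝ e z) • e := by
  rw [Submodule.reflection_orthogonal_apply, Submodule.reflection_singleton_apply, he]
  simp only [Real.ringHom_apply, one_pow, div_one]
  module

/-- The two evaluation points are antithetic: the value `f m` cancels, which leaves an error of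
second order in `s`. -/
theorem abs_mul_inner_add_reflection_sub_le {f : E → ℝ} (hf : Differentiable ℝ f) {e : E}
    (he : ‖e‖ = 1) {L : NNReal} (hL : LipschitzWith L fun a => fderiv ℝ f a e) (m z : E) {s : ℝ}
    (hs : 0 ≤ s) :
    |f (m + s • z) * inner ℝ e z
        + f (m + s • (ℝ ∙ e)ᗮ.reflection z) * inner ℝ e ((ℝ ∙ e)ᗮ.reflection z)
        - 2 * s * fderiv ℝ f m e * inner ℝ e z ^ 2|
      ≤ 2 * L * s ^ 2 * ‖z‖ ^ 3 := by
  set ρ := (ℝ ∙ e)ᗮ.reflection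
  set h := inner ℝ e z
  have hρz : ρ z = z - (2 * h) • e := reflection_orthogonal_span_singleton_apply he z
  have hflip : inner ℝ e (ρ z) = -h := by
    rw [hρz, inner_sub_right, real_inner_smul_right, real_inner_self_eq_norm_sq, he]
    ring
  have hh : |h| ≤ ‖z‖ := by simpa [he] using abs_real_inner_le_norm e z
  have hmirror : m + s • z = m + s • ρ z + (2 * s * h) • e := by rw [hρz]; module
  have hdist (y : E) : ‖m + s • y - m‖ = s * ‖y‖ := by
    rw [add_sub_cancel_left, norm_smul, Real.norm_of_nonneg hs]
  have hincrement := abs_sub_sub_mul_fderiv_le hf hL (m := m) (x := m + s • ρ z) (c := 2 * s * h)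
    (r := s * ‖z‖) (by rw [hdist, ρ.norm_map]) (by rw [← hmirror, hdist])
  rw [← hmirror] at hincrement
  calc |f (m + s • z) * h + f (m + s • ρ z) * inner ℝ e (ρ z) - 2 * s * fderiv ℝ f m e * h ^ 2|
      = |f (m + s • z) - f (m + s • ρ z) - 2 * s * h * fderiv ℝ f m e| * |h| := by
        rw [hflip, ← abs_mul]
        ring_nf
    _ ≤ |2 * s * h| * (L * (s * ‖z‖)) * |h| := by gcongr
    _ = 2 * L * s ^ 2 * (|h| * ‖z‖ * |h|) := by
        rw [abs_mul, abs_of_nonneg (by positivity : 0 ≤ 2 * s)]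
        ring
    _ ≤ 2 * L * s ^ 2 * (‖z‖ * ‖z‖ * ‖z‖) := by gcongr
    _ = _ := by ring

variable [FiniteDimensional ℝ E] [MeasurableSpace E] [BorelSpace E]

theorem integrable_norm_pow_stdGaussian (k : ℕ) :
    Integrable (fun z : E => ‖z‖ ^ k) (stdGaussian E) :=
  (IsGaussian.memLp_id (stdGaussian E) k (by simp)).integrable_norm_pow'

theorem integrable_inner_sq_stdGaussian (e : E) :
    Integrable (fun z => inner ℝ e z ^ 2) (stdGaussian E) :=
  ((IsGaussian.memLp_id (stdGaussian E) 2 (by simp)).const_inner e).integrable_sq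

theorem integral_inner_sq_stdGaussian (e : E) :
    ∫ z, inner ℝ e z ^ 2 ∂stdGaussian E = ‖e‖ ^ 2 := by
  have hvar := variance_dual_stdGaussian (E := E) (innerSL ℝ e)
  rw [variance_of_integral_eq_zero (by fun_prop) (integral_strongDual_stdGaussian _)] at hvar
  simpa using hvar

theorem abs_integral_mul_inner_sub_le {f : E → ℝ} (hf : Differentiable ℝ f) {e : E} (he : ‖e‖ = 1)
    {L : NNReal} (hL : LipschitzWith L fun a => fderiv ℝ f a e) (m : E) {s : ℝ} (hs : 0 ≤ s)
    (hint : Integrable (fun z => f (m + s • z) * inner ℝ e z) (stdGaussian E)) :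
    |∫ z, f (m + s • z) * inner ℝ e z ∂stdGaussian E - s * fderiv ℝ f m e|
      ≤ L * s ^ 2 * ∫ z, ‖z‖ ^ 3 ∂stdGaussian E := by
  set F : E → ℝ := fun z => f (m + s • z) * inner ℝ e z
  set c := fderiv ℝ f m e
  set ρ := (ℝ ∙ e)ᗮ.reflection
  have hρ : MeasurePreserving ρ (stdGaussian E) (stdGaussian E) :=
    ⟨ρ.continuous.measurable, stdGaussian_map ρ⟩
  have hρ_emb : MeasurableEmbedding ρ := ρ.toHomeomorph.measurableEmbedding
  have hint_ρ : Integrable (fun z => F (ρ z)) (stdGaussian E) :=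
    (hρ.integrable_comp_emb hρ_emb).2 hint
  have hsymm : 2 * (∫ z, F z ∂stdGaussian E - s * c)
      = ∫ z, (F z + F (ρ z) - 2 * s * c * inner ℝ e z ^ 2) ∂stdGaussian E := by
    rw [integral_sub (f := fun z => F z + F (ρ z)) (hint.add hint_ρ)
        ((integrable_inner_sq_stdGaussian e).const_mul _),
      integral_add hint hint_ρ, hρ.integral_comp hρ_emb, integral_const_mul,
      integral_inner_sq_stdGaussian, he]
    ring
  have hbound : |2 * (∫ z, F z ∂stdGaussian E - s * c)|
      ≤ ∫ z, 2 * L * s ^ 2 * ‖z‖ ^ 3 ∂stdGaussian E := by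
    rw [hsymm, ← Real.norm_eq_abs]
    refine norm_integral_le_of_norm_le ((integrable_norm_pow_stdGaussian 3).const_mul _)
      (Eventually.of_forall fun z => ?_)
    exact abs_mul_inner_add_reflection_sub_le hf he hL m z hs
  rw [integral_const_mul, abs_mul, abs_of_pos (two_pos : (0 : ℝ) < 2)] at hbound
  linarith

variable {F : Type*} [NormedAddCommGroup F] {Y : E → F} {m : E} {K S s : ℝ}

theorem memLp_two_stdGaussian_of_norm_le_mul (hs : 0 ≤ s) (hsS : s ≤ S)
    (hYm : AEStronglyMeasurable (fun z => Y (m + s • z)) (stdGaussian E))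
    (hY : ∀ y, ‖Y y‖ ≤ K * (1 + ‖y‖) * ‖y - m‖) :
    MemLp (fun z => Y (m + s • z)) 2 (stdGaussian E) := by
  rw [memLp_two_iff_integrable_sq_norm hYm]
  refine (((integrable_norm_pow_stdGaussian 2).add
    ((integrable_norm_pow_stdGaussian 4).const_mul (S ^ 2))).const_mul
      (3 * K ^ 2 * S ^ 2 * (1 + ‖m‖ ^ 2))).mono' (hYm.norm.pow 2) (Eventually.of_forall fun z => ?_)
  rw [Real.norm_of_nonneg (sq_nonneg _)]
  exact norm_sq_add_smul_le_of_norm_le_mul hs hsS hY z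

theorem integral_norm_sq_stdGaussian_le_of_norm_le_mul (hs : 0 ≤ s) (hsS : s ≤ S)
    (hY : ∀ y, ‖Y y‖ ≤ K * (1 + ‖y‖) * ‖y - m‖) :
    ∫ z, ‖Y (m + s • z)‖ ^ 2 ∂stdGaussian E
      ≤ 3 * K ^ 2 * S ^ 2 * (∫ z, (‖z‖ ^ 2 + S ^ 2 * ‖z‖ ^ 4) ∂stdGaussian E)
        * (1 + ‖m‖ ^ 2) := by
  rw [mul_right_comm, ← integral_const_mul]
  exact integral_mono_of_nonneg (Eventually.of_forall fun z => sq_nonneg _)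
    (((integrable_norm_pow_stdGaussian 2).add
      ((integrable_norm_pow_stdGaussian 4).const_mul _)).const_mul _)
    (Eventually.of_forall (norm_sq_add_smul_le_of_norm_le_mul hs hsS hY))

end GaussianSmoothing

section IsotropicGaussian

variable {N d : ℕ}

theorem gaussianReal_eq_map_add_mul (a s : ℝ) :
    gaussianReal a (s ^ 2).toNNReal = (gaussianReal 0 1).map fun y => a + s * y := by
  rw [show (fun y => a + s * y) = (fun y => a + y) ∘ (fun y => s * y) from rfl,
    ← Measure.map_map (by fun_prop) (by fun_prop), gaussianReal_map_const_mul,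
    gaussianReal_map_const_add, mul_zero, zero_add, mul_one, Real.toNNReal_of_nonneg (sq_nonneg s)]

theorem isotropicGaussian_eq_map_stdGaussian (m : JointSpace N d) (s : ℝ) :
    isotropicGaussian m s = (stdGaussian (JointSpace N d)).map fun z => m + s • z := by
  have hσ (p : Fin N × Fin d) : SigmaFinite ((gaussianReal 0 1).map fun y => m p + s * y) := by
    rw [← gaussianReal_eq_map_add_mul]
    infer_instance
  simp_rw [isotropicGaussian, gaussianReal_eq_map_add_mul]
  rw [← map_pi_eq_stdGaussian, Measure.map_map (by fun_prop) (by fun_prop),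
    ← Measure.pi_map_pi (fun p => by fun_prop), Measure.map_map (by fun_prop) (by fun_prop)]
  rfl

instance (m : JointSpace N d) (s : ℝ) : IsProbabilityMeasure (isotropicGaussian m s) := by
  rw [isotropicGaussian_eq_map_stdGaussian]
  exact Measure.isProbabilityMeasure_map (by fun_prop)

theorem integral_isotropicGaussian {F : Type*} [NormedAddCommGroup F] [NormedSpace ℝ F]
    (m : JointSpace N d) (s : ℝ) {f : JointSpace N d → F} (hf : StronglyMeasurable f) :
    ∫ y, f y ∂isotropicGaussian m s = ∫ z, f (m + s • z) ∂stdGaussian (JointSpace N d) := by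
  rw [isotropicGaussian_eq_map_stdGaussian]
  exact integral_map (by fun_prop) hf.aestronglyMeasurable

/-- The transition kernel `m ↦ N(m, s² I)`, by which a state is drawn from a mean. -/
noncomputable def isotropicGaussianKernel (s : ℝ) : Kernel (JointSpace N d) (JointSpace N d) where
  toFun m := isotropicGaussian m s
  measurable' := by
    refine Measure.measurable_of_measurable_coe _ fun B hB => ?_
    have hadd : Measurable fun q : JointSpace N d × JointSpace N d => q.1 + s • q.2 := by fun_prop
    convert measurable_measure_prodMk_left (ν := stdGaussian (JointSpace N d)) (hadd hB)
      using 2 with m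
    rw [isotropicGaussian_eq_map_stdGaussian, Measure.map_apply (by fun_prop) hB]
    rfl

instance (s : ℝ) : IsMarkovKernel (isotropicGaussianKernel (N := N) (d := d) s) :=
  ⟨fun m => inferInstanceAs (IsProbabilityMeasure (isotropicGaussian m s))⟩

end IsotropicGaussian

section GradientEstimate

variable {N d : ℕ}

theorem GrowsAtMostLinearly.exists_abs_le {n : Type*} [Fintype n] {f : EuclideanSpace ℝ n → ℝ}
    (h : GrowsAtMostLinearly f) (hf : Continuous f) :
    ∃ K, 0 ≤ K ∧ ∀ a, |f a| ≤ K * (1 + ‖a‖) := by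
  obtain ⟨K, Q, hK⟩ := h
  obtain ⟨B, hB⟩ := (isCompact_closedBall (0 : EuclideanSpace ℝ n) Q).exists_bound_of_continuousOn
    hf.continuousOn
  refine ⟨max |K| B, (abs_nonneg K).trans (le_max_left _ _), fun a => ?_⟩
  rcases le_total Q ‖a‖ with ha | ha
  · refine (hK a ha).trans ?_
    gcongr
    exact (le_abs_self K).trans (le_max_left _ _)
  · have hmax : 0 ≤ max |K| B := (abs_nonneg K).trans (le_max_left _ _)
    calc |f a| ≤ B := hB a (mem_closedBall_zero_iff.2 ha)
      _ ≤ max |K| B := le_max_right _ _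
      _ ≤ max |K| B * (1 + ‖a‖) := le_mul_of_one_le_right hmax (by linarith [norm_nonneg a])

theorem exists_forall_abs_le_of_growsAtMostLinearly {ι n : Type*} [Finite ι] [Fintype n]
    {f : ι → EuclideanSpace ℝ n → ℝ} (h : ∀ i, GrowsAtMostLinearly (f i))
    (hf : ∀ i, Continuous (f i)) : ∃ K, 0 ≤ K ∧ ∀ i a, |f i a| ≤ K * (1 + ‖a‖) := by
  cases nonempty_fintype ι
  choose K hK₀ hK using fun i => (h i).exists_abs_le (hf i)
  refine ⟨∑ i, K i, Finset.sum_nonneg fun i _ => hK₀ i, fun i a => (hK i a).trans ?_⟩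
  gcongr
  exact Finset.single_le_sum (fun j _ => hK₀ j) (Finset.mem_univ i)

/-- The vector with the blocks `J_i(y) (y^i - m^i)`. For a state `y` drawn from `N(m, s² I)` it
estimates `s²` times the game mapping at `m`. -/
noncomputable def ContinuousGame.payoffDirection (G : ContinuousGame N d) (m y : JointSpace N d) :
    JointSpace N d :=
  WithLp.toLp 2 fun p => G.J p.1 y * (y p - m p)

theorem ContinuousGame.continuous_payoffDirection {G : ContinuousGame N d}
    (hJ : ∀ i, Continuous (G.J i)) :
    Continuous fun q : JointSpace N d × JointSpace N d => G.payoffDirection q.1 q.2 := by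
  refine (PiLp.continuous_toLp 2 _).comp (continuous_pi fun p => ?_)
  have hJp := hJ p.1
  fun_prop

theorem ContinuousGame.norm_payoffDirection_le {G : ContinuousGame N d} {y : JointSpace N d}
    {B : ℝ} (hB₀ : 0 ≤ B) (hB : ∀ i, |G.J i y| ≤ B) (m : JointSpace N d) :
    ‖G.payoffDirection m y‖ ≤ B * ‖y - m‖ := by
  refine le_of_sq_le_sq ?_ (by positivity)
  rw [mul_pow, EuclideanSpace.norm_sq_eq, EuclideanSpace.norm_sq_eq, Finset.mul_sum]
  refine Finset.sum_le_sum fun p _ => ?_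
  rw [← mul_pow]
  refine pow_le_pow_left₀ (norm_nonneg _) ?_ 2
  change ‖G.J p.1 y * (y p - m p)‖ ≤ B * ‖y p - m p‖
  rw [norm_mul]
  gcongr
  exact hB p.1

theorem norm_le_sqrt_card_mul_of_forall_abs_le {n : Type*} [Fintype n] {v : EuclideanSpace ℝ n}
    {c : ℝ} (hc : 0 ≤ c) (h : ∀ p, |v p| ≤ c) : ‖v‖ ≤ √(Fintype.card n) * c := by
  rw [EuclideanSpace.norm_eq, ← Real.sqrt_sq hc, ← Real.sqrt_mul (Nat.cast_nonneg _)]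
  refine Real.sqrt_le_sqrt ?_
  rw [← nsmul_eq_mul, ← Finset.card_univ]
  exact Finset.sum_le_card_nsmul _ _ _ fun p _ => pow_le_pow_left₀ (norm_nonneg _) (h p) 2

theorem ContinuousGame.lipschitzWith_fderiv_single {G : ContinuousGame N d} {L : NNReal}
    {p : Fin N × Fin d} (hL : LipschitzWith L fun a => block (G.gameMapping a) p.1) :
    LipschitzWith L fun a => fderiv ℝ (G.J p.1) a (EuclideanSpace.single p 1) :=
  LipschitzWith.of_dist_le_mul fun a b =>
    (PiLp.dist_apply_le (block (G.gameMapping a) p.1) _ p.2).trans (hL.dist_le_mul a b)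

theorem exists_forall_lipschitzWith {ι α β : Type*} [Finite ι] [PseudoEMetricSpace α]
    [PseudoEMetricSpace β] {f : ι → α → β} (h : ∀ i, ∃ L : NNReal, LipschitzWith L (f i)) :
    ∃ L : NNReal, ∀ i, LipschitzWith L (f i) := by
  cases nonempty_fintype ι
  choose L hL using h
  exact ⟨∑ i, L i, fun i => (hL i).weaken (Finset.single_le_sum (by simp) (Finset.mem_univ i))⟩

theorem ContinuousGame.norm_integral_payoffDirection_sub_le {G : ContinuousGame N d}
    (hJ : ∀ i, Differentiable ℝ (G.J i)) {L : NNReal}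
    (hL : ∀ i, LipschitzWith L fun a => block (G.gameMapping a) i) (m : JointSpace N d) {s : ℝ}
    (hs : 0 < s) (hint : Integrable (fun z => G.payoffDirection m (m + s • z)) (stdGaussian _)) :
    ‖∫ z, G.payoffDirection m (m + s • z) ∂stdGaussian (JointSpace N d)
        - s ^ 2 • G.gameMapping m‖
      ≤ √(Fintype.card (Fin N × Fin d))
        * (L * ∫ z, ‖z‖ ^ 3 ∂stdGaussian (JointSpace N d)) * s ^ 3 := by
  rw [mul_assoc]
  refine norm_le_sqrt_card_mul_of_forall_abs_le (by positivity) fun p => ?_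
  set e : JointSpace N d := EuclideanSpace.single p 1
  have hcoord (z : JointSpace N d) : G.payoffDirection m (m + s • z) p
      = s * (G.J p.1 (m + s • z) * inner ℝ e z) := by
    change G.J p.1 (m + s • z) * (m p + s * z p - m p) = _
    rw [EuclideanSpace.inner_single_left, map_one]
    ring
  have hint_coord (q) : Integrable (fun z => G.payoffDirection m (m + s • z) q) (stdGaussian _) :=
    hint.eval_piLp q
  have hint_p : Integrable (fun z => G.J p.1 (m + s • z) * inner ℝ e z) (stdGaussian _) := by
    have h := hint_coord p
    simp only [hcoord] at h
    exact (integrable_const_mul_iff hs.ne'.isUnit _).1 h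
  have hsmoothing := abs_integral_mul_inner_sub_le (hJ p.1) (by simp)
    (G.lipschitzWith_fderiv_single (hL p.1)) m hs.le hint_p
  rw [PiLp.sub_apply, eval_integral_piLp hint_coord]
  simp only [hcoord, integral_const_mul]
  set I := ∫ z, G.J p.1 (m + s • z) * inner ℝ e z ∂stdGaussian (JointSpace N d)
  calc |s * I - s ^ 2 * fderiv ℝ (G.J p.1) m e| = s * |I - s * fderiv ℝ (G.J p.1) m e| := by
        rw [← abs_of_pos hs, ← abs_mul, abs_of_pos hs]
        ring_nf
    _ ≤ s * (L * s ^ 2 * ∫ z, ‖z‖ ^ 3 ∂stdGaussian (JointSpace N d)) := by gcongr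
    _ = _ := by ring

/-- The constant `C` controls the bias and the second moment of the gradient estimate
`G.payoffDirection` for all noise levels up to `S`. -/
structure GradientEstimateBounds (G : ContinuousGame N d) (S C : ℝ) : Prop where
  nonneg : 0 ≤ C
  memLp : ∀ m s, 0 < s → s ≤ S → MemLp (G.payoffDirection m) 2 (isotropicGaussian m s)
  bias_le : ∀ m s, 0 < s → s ≤ S →
    ‖∫ y, G.payoffDirection m y ∂isotropicGaussian m s - s ^ 2 • G.gameMapping m‖ ≤ C * s ^ 3
  second_moment_le : ∀ m s, 0 < s → s ≤ S →
    ∫ y, ‖G.payoffDirection m y‖ ^ 2 ∂isotropicGaussian m s ≤ C * (1 + ‖m‖ ^ 2)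

theorem exists_gradientEstimateBounds {G : ContinuousGame N d}
    (hJ : ∀ i, Differentiable ℝ (G.J i))
    (hlip : ∀ i, ∃ L : NNReal, LipschitzWith L fun a => block (G.gameMapping a) i)
    (hgrowth : ∀ i, GrowsAtMostLinearly (G.J i)) (S : ℝ) : ∃ C, GradientEstimateBounds G S C := by
  obtain ⟨L, hL⟩ := exists_forall_lipschitzWith hlip
  obtain ⟨K, hK₀, hK⟩ :=
    exists_forall_abs_le_of_growsAtMostLinearly hgrowth fun i => (hJ i).continuous
  set C₁ := √(Fintype.card (Fin N × Fin d)) * (L * ∫ z, ‖z‖ ^ 3 ∂stdGaussian (JointSpace N d))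
  set C₂ := 3 * K ^ 2 * S ^ 2
    * ∫ z, (‖z‖ ^ 2 + S ^ 2 * ‖z‖ ^ 4) ∂stdGaussian (JointSpace N d)
  have hC₁ : 0 ≤ C₁ := by positivity
  have hcont (m : JointSpace N d) : Continuous (G.payoffDirection m) :=
    (G.continuous_payoffDirection fun i => (hJ i).continuous).comp (Continuous.prodMk_right m)
  have hgrow (m y : JointSpace N d) : ‖G.payoffDirection m y‖ ≤ K * (1 + ‖y‖) * ‖y - m‖ :=
    G.norm_payoffDirection_le (by positivity) (fun i => hK i y) m
  have hmemLp (m : JointSpace N d) {s : ℝ} (hs : 0 < s) (hsS : s ≤ S) :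
      MemLp (fun z => G.payoffDirection m (m + s • z)) 2 (stdGaussian (JointSpace N d)) :=
    memLp_two_stdGaussian_of_norm_le_mul hs.le hsS
      ((hcont m).comp (by fun_prop)).aestronglyMeasurable (hgrow m)
  refine ⟨max C₁ C₂, hC₁.trans (le_max_left _ _), fun m s hs hsS => ?_, fun m s hs hsS => ?_,
    fun m s hs hsS => ?_⟩
  · rw [isotropicGaussian_eq_map_stdGaussian]
    exact (memLp_map_measure_iff (hcont m).aestronglyMeasurable (by fun_prop)).2 (hmemLp m hs hsS)
  · rw [integral_isotropicGaussian m s (hcont m).stronglyMeasurable]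
    refine (G.norm_integral_payoffDirection_sub_le hJ hL m hs
      ((hmemLp m hs hsS).integrable one_le_two)).trans ?_
    gcongr
    exact le_max_left _ _
  · have hcont_sq : Continuous fun y => ‖G.payoffDirection m y‖ ^ 2 := by fun_prop
    rw [integral_isotropicGaussian m s hcont_sq.stronglyMeasurable]
    refine (integral_norm_sq_stdGaussian_le_of_norm_le_mul hs.le hsS (hgrow m)).trans ?_
    gcongr
    exact le_max_right _ _

theorem GradientEstimateBounds.integrable_norm_sub_smul_sub_smul_sq {G : ContinuousGame N d}
    {S C s : ℝ} (hGS : GradientEstimateBounds G S C) (hs : 0 < s) (hsS : s ≤ S)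
    (q m : JointSpace N d) (g κ : ℝ) :
    Integrable (fun y => ‖q - g • G.payoffDirection m y - κ • m‖ ^ 2) (isotropicGaussian m s) :=
  (((memLp_const q).sub ((hGS.memLp m s hs hsS).const_smul g)).sub
    (memLp_const (κ • m))).integrable_norm_pow two_ne_zero

end GradientEstimate

section History

variable {N d : ℕ} {Ω : Type*}

theorem history_mono (x μ : ℕ → Ω → JointSpace N d) : Monotone (history x μ) := fun _ _ h =>
  sup_le_sup (biSup_mono fun _ hk => hk.trans_le h) (biSup_mono fun _ hk => hk.trans h)

theorem measurable_mean_history (x μ : ℕ → Ω → JointSpace N d) (t : ℕ) :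
    Measurable[history x μ t] (μ t) :=
  Measurable.of_comap_le (le_sup_of_le_right (le_iSup₂_of_le t le_rfl le_rfl))

theorem history_le [m0 : MeasurableSpace Ω] {x μ : ℕ → Ω → JointSpace N d}
    (hx : ∀ t, Measurable (x t)) (hμ : ∀ t, Measurable (μ t)) (t : ℕ) : history x μ t ≤ m0 :=
  sup_le (iSup₂_le fun k _ => (hx k).comap_le) (iSup₂_le fun k _ => (hμ k).comap_le)

/-- The filtration of the histories from time `1` on, as the initial mean need not be an action. -/
def historySucc [MeasurableSpace Ω] {x μ : ℕ → Ω → JointSpace N d}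
    (hx : ∀ t, Measurable (x t)) (hμ : ∀ t, Measurable (μ t)) :
    Filtration ℕ ‹MeasurableSpace Ω› where
  seq n := history x μ (n + 1)
  mono' _ _ h := history_mono x μ (Nat.succ_le_succ h)
  le' n := history_le hx hμ (n + 1)

end History

namespace IsPayoffBasedRun

variable {N d : ℕ} {G : ContinuousGame N d} {γ σ ε : ℕ → ℝ} {μ₀ : JointSpace N d} {Ω : Type*}
  [MeasurableSpace Ω] {P : Measure Ω} {x μ : ℕ → Ω → JointSpace N d}

theorem mean_succ_mem_jointActions (hrun : IsPayoffBasedRun G γ σ ε μ₀ P x μ) (t : ℕ) (ω : Ω) :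
    μ (t + 1) ω ∈ G.jointActions := fun i => (hrun.update t ω i).1

theorem norm_mean_succ_sub_le (hrun : IsPayoffBasedRun G γ σ ε μ₀ P x μ)
    (hA : ∀ i, Convex ℝ (G.A i)) {t : ℕ} (hσ : σ t ≠ 0) (ω : Ω) {w : JointSpace N d}
    (hw : w ∈ G.jointActions) :
    ‖μ (t + 1) ω - w‖ ≤ ‖μ t ω - w - γ t • G.payoffDirection (μ t ω) (x t ω)
      - (γ t * σ t ^ 2 * ε t) • μ t ω‖ := by
  have hproj (i : Fin N) : IsProjection (G.A i)
      (block (μ t ω - γ t • G.payoffDirection (μ t ω) (x t ω)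
        - (γ t * σ t ^ 2 * ε t) • μ t ω) i) (block (μ (t + 1) ω) i) := by
    convert hrun.update t ω i using 1
    ext k
    simp only [block, ContinuousGame.payoffDirection, PiLp.sub_apply, PiLp.smul_apply,
      PiLp.add_apply, smul_eq_mul]
    field_simp
    ring
  convert G.norm_sub_le_of_isProjection_block hA hproj hw using 2
  abel

theorem excessEnergy_mean_succ_le (hrun : IsPayoffBasedRun G γ σ ε μ₀ P x μ)
    (hA : ∀ i, Convex ℝ (G.A i)) {t : ℕ} (hσ : σ t ≠ 0) (ω : Ω) {a w : JointSpace N d}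
    (hw : w ∈ G.jointActions) (hwa : ‖w - a‖ ≤ ‖a‖) :
    excessEnergy a (μ (t + 1) ω) ≤ 1 + ‖μ t ω - w - γ t • G.payoffDirection (μ t ω) (x t ω)
      - (γ t * σ t ^ 2 * ε t) • μ t ω‖ ^ 2 := by
  unfold excessEnergy
  gcongr
  exact (norm_ballExcess_le_norm_sub (norm_nonneg a) hwa _).trans
    (hrun.norm_mean_succ_sub_le hA hσ ω hw)

variable [IsFiniteMeasure P]

theorem setLIntegral_mean_state_eq (hrun : IsPayoffBasedRun G γ σ ε μ₀ P x μ) (t : ℕ) {s : Set Ω}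
    (hs : MeasurableSet[history x μ t] s) {F : JointSpace N d × JointSpace N d → ENNReal}
    (hF : Measurable F) :
    ∫⁻ ω in s, F (μ t ω, x t ω) ∂P
      = ∫⁻ ω in s, ∫⁻ y, F (μ t ω, y) ∂isotropicGaussian (μ t ω) (σ t) ∂P :=
  setLIntegral_prodMk_eq_setLIntegral_lintegral (κ := isotropicGaussianKernel (σ t))
    (history_le hrun.measurable_state hrun.measurable_mean t) (measurable_mean_history x μ t)
    (hrun.measurable_state t) (hrun.state_law t) hs hF

theorem setLIntegral_excessEnergy_mean_succ_le (hrun : IsPayoffBasedRun G γ σ ε μ₀ P x μ)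
    (hA : ∀ i, Convex ℝ (G.A i)) (hJ : ∀ i, Continuous (G.J i)) {S C : ℝ}
    (hGS : GradientEstimateBounds G S C) {t : ℕ} (hσ : 0 < σ t) (hσS : σ t ≤ S)
    {a : JointSpace N d} {w : JointSpace N d → JointSpace N d} (hwm : Measurable w)
    (hw : ∀ ω, w (μ t ω) ∈ G.jointActions) (hwa : ∀ m, ‖w m - a‖ ≤ ‖a‖) {s : Set Ω}
    (hs : MeasurableSet[history x μ t] s) :
    ∫⁻ ω in s, ENNReal.ofReal (excessEnergy a (μ (t + 1) ω)) ∂P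
      ≤ ∫⁻ ω in s, ENNReal.ofReal (1 + ∫ y, ‖μ t ω - w (μ t ω)
        - γ t • G.payoffDirection (μ t ω) y - (γ t * σ t ^ 2 * ε t) • μ t ω‖ ^ 2
          ∂isotropicGaussian (μ t ω) (σ t)) ∂P := by
  set κ := γ t * σ t ^ 2 * ε t
  let Φ : JointSpace N d × JointSpace N d → ℝ := fun q =>
    1 + ‖q.1 - w q.1 - γ t • G.payoffDirection q.1 q.2 - κ • q.1‖ ^ 2
  have hΦ : Measurable fun q => ENNReal.ofReal (Φ q) := by
    have hdir := (G.continuous_payoffDirection hJ).measurable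
    fun_prop
  calc ∫⁻ ω in s, ENNReal.ofReal (excessEnergy a (μ (t + 1) ω)) ∂P
      ≤ ∫⁻ ω in s, ENNReal.ofReal (Φ (μ t ω, x t ω)) ∂P := lintegral_mono fun ω =>
        ENNReal.ofReal_le_ofReal (hrun.excessEnergy_mean_succ_le hA hσ.ne' ω (hw ω) (hwa _))
    _ = ∫⁻ ω in s, ∫⁻ y, ENNReal.ofReal (Φ (μ t ω, y)) ∂isotropicGaussian (μ t ω) (σ t) ∂P :=
        hrun.setLIntegral_mean_state_eq t hs hΦ
    _ = _ := by
        refine lintegral_congr fun ω => ?_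
        have hint := hGS.integrable_norm_sub_smul_sub_smul_sq hσ hσS (μ t ω - w (μ t ω)) (μ t ω)
          (γ t) κ
        have hΦint : Integrable (fun y => Φ (μ t ω, y)) (isotropicGaussian (μ t ω) (σ t)) :=
          (integrable_const 1).add hint
        rw [← ofReal_integral_eq_lintegral_ofReal hΦint
          (Eventually.of_forall fun y => add_nonneg zero_le_one (sq_nonneg _)),
          integral_add (integrable_const 1) hint, integral_const, probReal_univ, one_smul]

theorem lintegral_excessEnergy_mean_one_ne_top (hrun : IsPayoffBasedRun G γ σ ε μ₀ P x μ)
    (hA : ∀ i, Convex ℝ (G.A i)) (hJ : ∀ i, Continuous (G.J i)) {S C : ℝ}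
    (hGS : GradientEstimateBounds G S C) (hσ : 0 < σ 0) (hσS : σ 0 ≤ S)
    {a : JointSpace N d} (ha : a ∈ G.jointActions) :
    ∫⁻ ω, ENNReal.ofReal (excessEnergy a (μ 1 ω)) ∂P ≠ ⊤ := by
  have hle := hrun.setLIntegral_excessEnergy_mean_succ_le hA hJ hGS hσ hσS (a := a)
    (measurable_const (a := a)) (fun _ => ha) (by simp) MeasurableSet.univ
  simp only [Measure.restrict_univ, hrun.init, lintegral_const] at hle
  exact ne_top_of_le_ne_top (ENNReal.mul_ne_top ENNReal.ofReal_ne_top (measure_ne_top P _)) hle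

theorem setLIntegral_excessEnergy_mean_succ_le_mul (hrun : IsPayoffBasedRun G γ σ ε μ₀ P x μ)
    (hA : ∀ i, Convex ℝ (G.A i)) (hJ : ∀ i, Continuous (G.J i)) {S C T : ℝ}
    (hGS : GradientEstimateBounds G S C) {t : ℕ} (hγ : 0 ≤ γ t) (hσ : 0 < σ t) (hσS : σ t ≤ S)
    (hε : 0 ≤ ε t) (hT : σ t ^ 2 * ε t ≤ T) {a : JointSpace N d}
    (ha : a ∈ mintySolutions G.jointActions G.gameMapping) (hμ : ∀ ω, μ t ω ∈ G.jointActions)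
    {s : Set Ω} (hs : MeasurableSet[history x μ t] s) :
    ∫⁻ ω in s, ENNReal.ofReal (excessEnergy a (μ (t + 1) ω)) ∂P
      ≤ ENNReal.ofReal (1 + energyGrowth a C T (γ t) (σ t))
        * ∫⁻ ω in s, ENNReal.ofReal (excessEnergy a (μ t ω)) ∂P := by
  have hgrowth : 0 ≤ 1 + energyGrowth a C T (γ t) (σ t) := by
    linarith [energyGrowth_nonneg a hGS.nonneg T hγ hσ.le]
  refine (hrun.setLIntegral_excessEnergy_mean_succ_le hA hJ hGS hσ hσS
    (w := fun m => m - ballExcess a ‖a‖ m) (by fun_prop)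
    (fun ω => sub_ballExcess_mem (G.convex_jointActions hA) (norm_nonneg a) ha.1 (hμ ω))
    (norm_sub_ballExcess_sub_le (norm_nonneg a) a) hs).trans ?_
  rw [← lintegral_const_mul' _ _ ENNReal.ofReal_ne_top]
  refine lintegral_mono fun ω => ?_
  rw [← ENNReal.ofReal_mul hgrowth]
  refine ENNReal.ofReal_le_ofReal ?_
  simp only [sub_sub_cancel]
  refine (add_le_add_right (integral_norm_sub_smul_sub_smul_sq_le
    (hGS.memLp (μ t ω) (σ t) hσ hσS) _ _ _ _) 1).trans ?_
  exact expected_energy_le_mul_excessEnergy (ha.2 _ (hμ ω)) hGS.nonneg hγ (by positivity)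
    (by rw [mul_assoc]; gcongr) (hGS.bias_le _ _ hσ hσS) (hGS.second_moment_le _ _ hσ hσS)

theorem ae_bddAbove_range_excessEnergy_mean_succ (hrun : IsPayoffBasedRun G γ σ ε μ₀ P x μ)
    (hA : ∀ i, Convex ℝ (G.A i)) (hJ : ∀ i, Continuous (G.J i)) {S C T : ℝ}
    (hGS : GradientEstimateBounds G S C) (hγ : ∀ t, 0 ≤ γ t) (hσ : ∀ t, 0 < σ t)
    (hσS : ∀ t, σ t ≤ S) (hε : ∀ t, 0 ≤ ε t) (hT : ∀ t, σ t ^ 2 * ε t ≤ T)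
    (hγsum : Summable fun t => γ t ^ 2) (hγσsum : Summable fun t => γ t * σ t ^ 2 * σ t)
    {a : JointSpace N d} (ha : a ∈ mintySolutions G.jointActions G.gameMapping) :
    ∀ᵐ ω ∂P, BddAbove (Set.range fun n => excessEnergy a (μ (n + 1) ω)) := by
  have hV : Measurable (excessEnergy a) := by
    unfold excessEnergy
    fun_prop
  refine ae_bddAbove_range_of_setLIntegral_succ_le
    (ℱ := historySucc hrun.measurable_state hrun.measurable_mean)
    (θ := fun n => energyGrowth a C T (γ (n + 1)) (σ (n + 1)))
    (fun n => hV.comp (measurable_mean_history x μ (n + 1))) (fun n ω => excessEnergy_nonneg a _)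
    (hrun.lintegral_excessEnergy_mean_one_ne_top hA hJ hGS (hσ 0) (hσS 0) ha.1)
    (fun n => energyGrowth_nonneg a hGS.nonneg T (hγ _) (hσ _).le)
    ((summable_nat_add_iff 1).2 (summable_energyGrowth a C T hγsum hγσsum)) fun n s hs => ?_
  exact hrun.setLIntegral_excessEnergy_mean_succ_le_mul hA hJ hGS (hγ _) (hσ _) (hσS _) (hε _)
    (hT _) ha (hrun.mean_succ_mem_jointActions n) hs

end IsPayoffBasedRun

theorem bddAbove_range_norm_of_bddAbove_range_excessEnergy_succ {E : Type*}
    [NormedAddCommGroup E] [NormedSpace ℝ E] {a : E} {u : ℕ → E}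
    (h : BddAbove (Set.range fun n => excessEnergy a (u (n + 1)))) :
    BddAbove (Set.range fun t => ‖u t‖) := by
  obtain ⟨B, hB⟩ := h
  refine ⟨max ‖u 0‖ ((2 + 8 * ‖a‖ ^ 2) * B), ?_⟩
  rintro _ ⟨_ | n, rfl⟩
  · exact le_max_left _ _
  · have hEB : excessEnergy a (u (n + 1)) ≤ B := hB ⟨n, rfl⟩
    calc ‖u (n + 1)‖ ≤ 1 + ‖u (n + 1)‖ ^ 2 := by nlinarith [sq_nonneg (‖u (n + 1)‖ - 1)]
      _ ≤ (2 + 8 * ‖a‖ ^ 2) * excessEnergy a (u (n + 1)) :=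
        one_add_norm_sq_le_mul_excessEnergy a _
      _ ≤ (2 + 8 * ‖a‖ ^ 2) * B := by gcongr
      _ ≤ _ := le_max_right _ _

theorem pos_of_eq_one_div_rpow {u : ℕ → ℝ} {r : ℝ} (h0 : 0 < u 0)
    (hu : ∀ t : ℕ, 1 ≤ t → u t = 1 / (t : ℝ) ^ r) (t : ℕ) : 0 < u t := by
  rcases t.eq_zero_or_pos with rfl | ht
  · exact h0
  · rw [hu t ht]
    positivity

namespace StepSizeConditions

variable {a b c : ℝ} {γ σ ε : ℕ → ℝ}

theorem gamma_pos (h : StepSizeConditions a b c γ σ ε) : ∀ t, 0 < γ t :=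
  pos_of_eq_one_div_rpow h.gamma_zero_pos h.gamma_eq

theorem sigma_pos (h : StepSizeConditions a b c γ σ ε) : ∀ t, 0 < σ t :=
  pos_of_eq_one_div_rpow h.sigma_zero_pos h.sigma_eq

theorem eps_pos (h : StepSizeConditions a b c γ σ ε) : ∀ t, 0 < ε t :=
  pos_of_eq_one_div_rpow h.eps_zero_pos h.eps_eq

end StepSizeConditions

theorem lemma3_general {N d : ℕ} (G : ContinuousGame N d) (hA : ∀ i, Convex ℝ (G.A i))
    (hJ : ∀ i, Differentiable ℝ (G.J i))
    (hsol : (mintySolutions G.jointActions G.gameMapping).Nonempty)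
    (hlip : ∀ i, ∃ L : NNReal, LipschitzWith L fun a => block (G.gameMapping a) i)
    (hgrowth : ∀ i, GrowsAtMostLinearly (G.J i)) {γ σ ε : ℕ → ℝ} (hγ : ∀ t, 0 ≤ γ t)
    (hσ : ∀ t, 0 < σ t) (hε : ∀ t, 0 ≤ ε t) (hσ_bdd : BddAbove (Set.range σ))
    (hε_bdd : BddAbove (Set.range ε)) (hγsum : Summable fun t => γ t ^ 2)
    (hγσsum : Summable fun t => γ t * σ t ^ 2 * σ t) (μ₀ : JointSpace N d) {Ω : Type*}
    [MeasurableSpace Ω] (P : Measure Ω) [IsProbabilityMeasure P] (x μ : ℕ → Ω → JointSpace N d)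
    (hrun : IsPayoffBasedRun G γ σ ε μ₀ P x μ) :
    P {ω | BddAbove (Set.range fun t => ‖μ t ω‖)} = 1 := by
  obtain ⟨a, ha⟩ := hsol
  obtain ⟨S, hS⟩ := hσ_bdd
  obtain ⟨R, hR⟩ := hε_bdd
  have hσS (t : ℕ) : σ t ≤ S := hS ⟨t, rfl⟩
  have hT (t : ℕ) : σ t ^ 2 * ε t ≤ S ^ 2 * R :=
    mul_le_mul (pow_le_pow_left₀ (hσ t).le (hσS t) 2) (hR ⟨t, rfl⟩) (hε t) (sq_nonneg S)
  obtain ⟨C, hGS⟩ := exists_gradientEstimateBounds hJ hlip hgrowth S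
  have henergy := hrun.ae_bddAbove_range_excessEnergy_mean_succ hA (fun i => (hJ i).continuous)
    hGS hγ hσ hσS hε hT hγsum hγσsum ha
  refine (measure_congr (eventuallyEq_univ.2 ?_)).trans measure_univ
  filter_upwards [henergy] with ω hω using
    bddAbove_range_norm_of_bddAbove_range_excessEnergy_succ hω

theorem lemma3 {N d : ℕ} (G : ContinuousGame N d)
    -- the action sets are closed and convex, and the cost functions are differentiable
    (hA_closed : ∀ i, IsClosed (G.A i)) (hA_convex : ∀ i, Convex ℝ (G.A i))
    (hJ : ∀ i, Differentiable ℝ (G.J i))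
    -- the game mapping is monotone on the set of joint actions
    (hmono : MonotoneMappingOn G.gameMapping G.jointActions)
    -- the variational inequality has a solution
    (hsol : (viSolutions G.jointActions G.gameMapping).Nonempty)
    -- each component of the game mapping is Lipschitz continuous
    (hlip : ∀ i, ∃ L : NNReal, LipschitzWith L (fun a => block (G.gameMapping a) i))
    -- the cost functions grow at most linearly
    (hgrowth : ∀ i, GrowsAtMostLinearly (G.J i))
    -- the parameters of the algorithm
    (a b c : ℝ) (γ σ ε : ℕ → ℝ) (hstep : StepSizeConditions a b c γ σ ε)
    -- a run of the algorithm from an arbitrary initial mean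
    (μ₀ : JointSpace N d) {Ω : Type*} [MeasurableSpace Ω] (P : Measure Ω) [IsProbabilityMeasure P]
    (x μ : ℕ → Ω → JointSpace N d) (hrun : IsPayoffBasedRun G γ σ ε μ₀ P x μ) :
    P {ω | BddAbove (Set.range fun t => ‖μ t ω‖)} = 1 :=
  lemma3_general G hA_convex hJ (hsol.mono hmono.viSolutions_subset_mintySolutions) hlip hgrowth
    (fun t => (hstep.gamma_pos t).le) hstep.sigma_pos (fun t => (hstep.eps_pos t).le)
    hstep.tendsto_sigma.bddAbove_range hstep.tendsto_eps.bddAbove_range hstep.summable_gamma_sq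
    hstep.summable_beta_sigma μ₀ P x μ hrun
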